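/- For graphs $H$ and $F$ and a positive integer $n$, let $\mathrm{rex}(n,H,F)$ denote the largest number of (not necessarily induced) copies of $H$ in an $F$-free regular graph on $n$ vertices, where the degree of regularity is arbitrary and the maximum over an empty family is $0$. A finite graph $F$ is called an extended friendship graph if every cycle of $F$ is a triangle and there is a vertex $v$ of $F$ that is contained in all triangles of $F$ ($F$ may have no triangles). Theorem. Let $F$ be a finite graph with at least one vertex. Then $\mathrm{rex}(n,K_3,F)=O(n)$ as $n\to\infty$ (with a constant depending on $F$) if and only if $F$ is an extended friendship graph. -/

import Mathlib

open Filter Asymptotics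

namespace SimpleGraph

/-- The number `rex(n, H, F)`: the largest number of (not necessarily induced, unlabelled) copies
of `H` in an `F`-free regular graph on `n` vertices. The degree of regularity is arbitrary.
It is `0` if there is no such graph, which can only happen if `F` has no edges. -/
noncomputable def rex (n : ℕ) {U W : Type*} (H : SimpleGraph U) (F : SimpleGraph W) : ℕ := by
  classical
  exact (Finset.univ.filter fun G : SimpleGraph (Fin n) =>
    F.Free G ∧ ∃ r : ℕ, G.IsRegularOfDegree r).sup fun G => G.copyCount H

/-- An extended friendship graph: every cycle is a triangle, and all triangles share a common
vertex. (There may be no triangle at all.) -/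
def IsExtendedFriendship {W : Type*} (F : SimpleGraph W) : Prop :=
  (∀ (u : W) (p : F.Walk u u), p.IsCycle → p.length = 3) ∧
    ∃ v : W, ∀ t : Finset W, F.IsNClique 3 t → v ∈ t

end SimpleGraph

namespace SimpleGraph

/-! Let `F` be an extended friendship graph with centre `v`. The edges opposite to `v` in its
triangles form a matching, and deleting them leaves a forest. Hence `F` embeds in any graph of
minimum degree at least `|W|` that has `|W|` triangles meeting only in one vertex: put the triangles
of `F` on this windmill and add the rest greedily along a tree (`IsExtendedFriendship.isContained`).
A graph without large windmills has only linearly many triangles (`card_ordered_triangles_le`).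
Regularity covers the remaining case: if one degree is below `|W|`, all are, and the triangle count
is trivially linear.

Conversely, each way of failing the definition has its own regular `F`-free graphs. If the triangles
of `F` have no common vertex, `coneGraph` works: all its triangles share a vertex, and there are
quadratically many. If `F` has a cycle of length `ℓ ≥ 4`, `wordCayleyGraph` works: every generator
of order 3 puts a triangle on each vertex, while the generators act on truncated reduced words
freely enough to exclude cycles of length `ℓ` (`not_isCycle_wordCayleyGraph`). The number of
generators is arbitrary, so no linear bound survives. -/

/-! ### Counting triangles in graphs without large windmills -/

/-- `k` triangles of `G` that pairwise meet exactly in `x`. -/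
def HasWindmill {V : Type*} (G : SimpleGraph V) (x : V) (k : ℕ) : Prop :=
  ∃ a b : Fin k → V, Function.Injective a ∧ Function.Injective b ∧ (∀ i j, a i ≠ b j) ∧
    ∀ i, G.Adj x (a i) ∧ G.Adj x (b i) ∧ G.Adj (a i) (b i)

/-- Greedy choice: a chosen pair meets at most `4 * D` pairs, since either of its two elements may
occur in either coordinate. -/
theorem exists_disjoint_pairs_of_lt_card {α : Type*} [DecidableEq α] (D k : ℕ) :
    ∀ S : Finset (α × α), (∀ p ∈ S, p.1 ≠ p.2) → (∀ a, (S.filter fun p => p.1 = a).card ≤ D) →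
      (∀ a, (S.filter fun p => p.2 = a).card ≤ D) → 4 * D * k < S.card →
      ∃ a b : Fin k → α, Function.Injective a ∧ Function.Injective b ∧ (∀ i j, a i ≠ b j) ∧
        ∀ i, (a i, b i) ∈ S := by
  induction k with
  | zero =>
    intro S _ _ _ _
    exact ⟨Fin.elim0, Fin.elim0, fun i => i.elim0, fun i => i.elim0, fun i => i.elim0,
      fun i => i.elim0⟩
  | succ k ih =>
    intro S hne h1 h2 hS
    obtain ⟨⟨a₀, b₀⟩, hab⟩ : S.Nonempty := Finset.card_pos.mp (by omega)
    set S' := S.filter fun p => p.1 ≠ a₀ ∧ p.1 ≠ b₀ ∧ p.2 ≠ a₀ ∧ p.2 ≠ b₀ with hS'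
    have hsub : S ⊆ S' ∪ ((S.filter (fun p => p.1 = a₀) ∪ S.filter (fun p => p.1 = b₀)) ∪
        (S.filter (fun p => p.2 = a₀) ∪ S.filter (fun p => p.2 = b₀))) := by
      intro p hp
      simp only [hS', Finset.mem_union, Finset.mem_filter, hp, true_and]
      tauto
    have hcard : S.card ≤ S'.card + 4 * D := by
      refine (Finset.card_le_card hsub).trans ((Finset.card_union_le _ _).trans ?_)
      have e1 := Finset.card_union_le (S.filter (fun p => p.1 = a₀) ∪ S.filter (fun p => p.1 = b₀))
        (S.filter (fun p => p.2 = a₀) ∪ S.filter (fun p => p.2 = b₀))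
      have e2 := Finset.card_union_le (S.filter (fun p => p.1 = a₀)) (S.filter (fun p => p.1 = b₀))
      have e3 := Finset.card_union_le (S.filter (fun p => p.2 = a₀)) (S.filter (fun p => p.2 = b₀))
      have := h1 a₀
      have := h1 b₀
      have := h2 a₀
      have := h2 b₀
      omega
    have hss : S' ⊆ S := Finset.filter_subset _ _
    obtain ⟨a, b, ha, hb, hd, hm⟩ := ih S' (fun p hp => hne p (hss hp))
      (fun x => (Finset.card_le_card (Finset.filter_subset_filter _ hss)).trans (h1 x))
      (fun x => (Finset.card_le_card (Finset.filter_subset_filter _ hss)).trans (h2 x))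
      (by rw [mul_add, mul_one] at hS; omega)
    have hm' : ∀ i, a i ≠ a₀ ∧ a i ≠ b₀ ∧ b i ≠ a₀ ∧ b i ≠ b₀ := fun i =>
      (Finset.mem_filter.mp (hm i)).2
    refine ⟨Fin.cons a₀ a, Fin.cons b₀ b, ?_, ?_, ?_, ?_⟩
    · rw [Fin.cons_injective_iff]
      exact ⟨fun ⟨i, hi⟩ => (hm' i).1 hi, ha⟩
    · rw [Fin.cons_injective_iff]
      exact ⟨fun ⟨i, hi⟩ => (hm' i).2.2.2 hi, hb⟩
    · intro i j
      refine Fin.cases ?_ (fun i => ?_) i <;> refine Fin.cases ?_ (fun j => ?_) j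
      · simpa using hne _ hab
      · simpa using (hm' j).2.2.1.symm
      · simpa using (hm' i).2.1
      · simpa using hd i j
    · intro i
      refine Fin.cases ?_ (fun i => ?_) i
      · simpa using hab
      · simpa using hss (hm i)

theorem copyCount_triangle_le_card {V : Type*} [Fintype V] (G : SimpleGraph V)
    (T : Finset (V × V × V))
    (hT : ∀ x y z, G.Adj x y → G.Adj x z → G.Adj y z → (x, y, z) ∈ T) :
    G.copyCount (completeGraph (Fin 3)) ≤ T.card := by
  have hf : ∀ (f : Copy (completeGraph (Fin 3)) G) (i j : Fin 3), i ≠ j → G.Adj (f i) (f j) :=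
    fun f i j hij => f.toHom.map_adj (show (completeGraph (Fin 3)).Adj i j from hij)
  let φ : Copy (completeGraph (Fin 3)) G → T := fun f =>
    ⟨(f 0, f 1, f 2), hT _ _ _ (hf f 0 1 (by decide)) (hf f 0 2 (by decide))
      (hf f 1 2 (by decide))⟩
  have hφ : Function.Injective φ := by
    intro f g hfg
    have h := congrArg Subtype.val hfg
    simp only [φ, Prod.mk.injEq] at h
    ext i
    fin_cases i
    · exact h.1
    · exact h.2.1
    · exact h.2.2
  have key : ∀ _ : Fintype (Copy (completeGraph (Fin 3)) G),
      Fintype.card (Copy (completeGraph (Fin 3)) G) ≤ T.card := fun _ =>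
    (Fintype.card_le_of_injective φ hφ).trans_eq (Fintype.card_coe T)
  refine copyCount_le_labelledCopyCount.trans ?_
  rw [labelledCopyCount]
  exact key _

theorem copyCount_triangle_le {V : Type*} [Fintype V] (G : SimpleGraph V) [DecidableRel G.Adj] :
    G.copyCount (completeGraph (Fin 3)) ≤ (Finset.univ.filter fun p : V × V × V =>
      G.Adj p.1 p.2.1 ∧ G.Adj p.1 p.2.2 ∧ G.Adj p.2.1 p.2.2).card :=
  G.copyCount_triangle_le_card _ fun _ _ _ h1 h2 h3 =>
    Finset.mem_filter.mpr ⟨Finset.mem_univ _, h1, h2, h3⟩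

section Count

variable {V : Type*} [Fintype V] [DecidableEq V] (G : SimpleGraph V) [DecidableRel G.Adj]

/-- Otherwise `k` heavy neighbours serve as one end of each blade. Each still has `2k - k` common
neighbours with `x` outside the chosen set, so Hall's theorem supplies distinct other ends. -/
theorem card_heavy_neighbors_lt {x : V} {k : ℕ} (h : ¬ G.HasWindmill x k) :
    (Finset.univ.filter fun y => G.Adj x y ∧
      2 * k ≤ (G.neighborFinset x ∩ G.neighborFinset y).card).card < k := by
  by_contra! hk
  obtain ⟨Y, hY, hYk⟩ := Finset.exists_subset_card_eq hk
  apply h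
  have hY' : ∀ y ∈ Y, G.Adj x y ∧ 2 * k ≤ (G.neighborFinset x ∩ G.neighborFinset y).card :=
    fun y hy => (Finset.mem_filter.mp (hY hy)).2
  let e : Fin k ≃ Y := (Y.equivFinOfCardEq hYk).symm
  let S : Fin k → Finset V := fun i =>
    (G.neighborFinset x ∩ G.neighborFinset (e i : V)) \ Y
  have hS : ∀ i, k ≤ (S i).card := by
    intro i
    have h1 := (hY' _ (e i).2).2
    have h2 := Finset.le_card_sdiff Y (G.neighborFinset x ∩ G.neighborFinset (e i : V))
    change k ≤ ((G.neighborFinset x ∩ G.neighborFinset (e i : V)) \ Y).card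
    omega
  obtain ⟨f, hf, hfS⟩ := (Finset.all_card_le_biUnion_card_iff_exists_injective S).mp (by
    intro s
    rcases s.eq_empty_or_nonempty with rfl | ⟨i, hi⟩
    · simp
    · calc s.card ≤ k := by simpa using Finset.card_le_univ s
        _ ≤ (S i).card := hS i
        _ ≤ _ := Finset.card_le_card (Finset.subset_biUnion_of_mem S hi))
  refine ⟨fun i => e i, f, fun i j hij => e.injective (Subtype.ext hij), hf, ?_, ?_⟩
  · intro i j hij
    have := (Finset.mem_sdiff.mp (hfS j)).2
    exact this (hij ▸ (e i).2)
  · intro i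
    have := (Finset.mem_sdiff.mp (hfS i)).1
    rw [Finset.mem_inter, mem_neighborFinset, mem_neighborFinset] at this
    exact ⟨(hY' _ (e i).2).1, this.1, this.2⟩

/-- The light pairs form a graph of maximum degree below `2 * k` on the neighbours of `x`; too many
edges would give `k` disjoint ones, that is, a windmill. -/
theorem card_light_pairs_le {x : V} {k : ℕ} (h : ¬ G.HasWindmill x k) :
    (Finset.univ.filter fun p : V × V => G.Adj x p.1 ∧ G.Adj x p.2 ∧ G.Adj p.1 p.2 ∧
      (G.neighborFinset x ∩ G.neighborFinset p.1).card < 2 * k ∧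
      (G.neighborFinset x ∩ G.neighborFinset p.2).card < 2 * k).card ≤ 4 * (2 * k) * k := by
  by_contra! hk
  apply h
  have key := exists_disjoint_pairs_of_lt_card (2 * k) k _ ?_ ?_ ?_ hk
  · obtain ⟨a, b, ha, hb, hd, hm⟩ := key
    refine ⟨a, b, ha, hb, hd, fun i => ?_⟩
    have := (Finset.mem_filter.mp (hm i)).2
    exact ⟨this.1, this.2.1, this.2.2.1⟩
  · intro p hp
    exact (Finset.mem_filter.mp hp).2.2.2.1.ne
  · intro a
    by_cases hl : (G.neighborFinset x ∩ G.neighborFinset a).card < 2 * k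
    · refine le_trans (Finset.card_le_card_of_injOn Prod.snd ?_ ?_) hl.le
      · rintro ⟨y, z⟩ hp
        simp only [Finset.coe_filter, Finset.mem_filter, Finset.mem_univ, true_and,
          Set.mem_ofPred_eq] at hp
        obtain ⟨hp, rfl⟩ := hp
        simp [hp.2.1, hp.2.2.1]
      · rintro ⟨y, z⟩ hp ⟨y', z'⟩ hp' hzz
        simp only [Finset.coe_filter, Finset.mem_filter, Finset.mem_univ, true_and,
          Set.mem_ofPred_eq] at hp hp' hzz
        rw [hp.2, hp'.2, hzz]
    · rw [Finset.filter_eq_empty_iff.mpr, Finset.card_empty]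
      · exact Nat.zero_le _
      · rintro ⟨y, z⟩ hp rfl
        exact hl (Finset.mem_filter.mp hp).2.2.2.2.1
  · intro a
    by_cases hl : (G.neighborFinset x ∩ G.neighborFinset a).card < 2 * k
    · refine le_trans (Finset.card_le_card_of_injOn Prod.fst ?_ ?_) hl.le
      · rintro ⟨y, z⟩ hp
        simp only [Finset.coe_filter, Finset.mem_filter, Finset.mem_univ, true_and,
          Set.mem_ofPred_eq] at hp
        obtain ⟨hp, rfl⟩ := hp
        simp [hp.1, hp.2.2.1.symm]
      · rintro ⟨y, z⟩ hp ⟨y', z'⟩ hp' hzz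
        simp only [Finset.coe_filter, Finset.mem_filter, Finset.mem_univ, true_and,
          Set.mem_ofPred_eq] at hp hp' hzz
        rw [hp.2, hp'.2, hzz]
    · rw [Finset.filter_eq_empty_iff.mpr, Finset.card_empty]
      · exact Nat.zero_le _
      · rintro ⟨y, z⟩ hp rfl
        exact hl (Finset.mem_filter.mp hp).2.2.2.2.2

/-- Pigeonhole: when the edges of a triangle have two colours, two edges at some vertex agree. -/
theorem iff_or_iff_or_iff (P Q R : Prop) : (P ↔ R) ∨ (Q ↔ P) ∨ (R ↔ Q) := by
  tauto

/-- The number of ordered triangles is linear if no vertex is the centre of a large windmill. -/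
theorem card_ordered_triangles_le {k : ℕ} (h : ∀ x, ¬ G.HasWindmill x k) :
    (Finset.univ.filter fun p : V × V × V => G.Adj p.1 p.2.1 ∧ G.Adj p.1 p.2.2 ∧
      G.Adj p.2.1 p.2.2).card ≤ 27 * k ^ 2 * Fintype.card V := by
  -- Heaviness is a symmetric 2-colouring of edges. `S` keeps the triangles whose two edges at the
  -- first vertex have the same colour; by pigeonhole, its three rotations cover all triangles.
  let heavy : V → V → Prop := fun x y =>
    2 * k ≤ (G.neighborFinset x ∩ G.neighborFinset y).card
  have heavy_comm : ∀ x y, heavy x y ↔ heavy y x := fun x y => by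
    simp only [heavy, Finset.inter_comm]
  set S : Finset (V × V × V) := Finset.univ.filter fun p => (G.Adj p.1 p.2.1 ∧ G.Adj p.1 p.2.2 ∧
      G.Adj p.2.1 p.2.2) ∧ (heavy p.1 p.2.1 ↔ heavy p.1 p.2.2) with hS
  have hScard : S.card ≤ 9 * k ^ 2 * Fintype.card V := by
    have hmaps : ∀ p ∈ S, p.1 ∈ (Finset.univ : Finset V) := fun _ _ => Finset.mem_univ _
    refine Finset.card_le_mul_card_image_of_maps_to hmaps _ fun x _ => ?_
    set A := Finset.univ.filter fun y => G.Adj x y ∧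
      2 * k ≤ (G.neighborFinset x ∩ G.neighborFinset y).card with hA
    have hAk : A.card ≤ k := (G.card_heavy_neighbors_lt (h x)).le
    set B := Finset.univ.filter fun p : V × V => G.Adj x p.1 ∧ G.Adj x p.2 ∧ G.Adj p.1 p.2 ∧
      (G.neighborFinset x ∩ G.neighborFinset p.1).card < 2 * k ∧
      (G.neighborFinset x ∩ G.neighborFinset p.2).card < 2 * k with hB
    have hBk : B.card ≤ 4 * (2 * k) * k := G.card_light_pairs_le (h x)
    calc (S.filter fun p => p.1 = x).card ≤ (A ×ˢ A ∪ B).card := by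
          refine Finset.card_le_card_of_injOn Prod.snd ?_ ?_
          · rintro ⟨x', y, z⟩ hp
            simp only [hS, Finset.coe_filter, Finset.mem_filter, Finset.mem_univ, true_and,
              Set.mem_ofPred_eq] at hp
            obtain ⟨⟨hp, hh⟩, rfl⟩ := hp
            simp only [Finset.coe_union, Set.mem_union, Finset.mem_coe, Finset.mem_product, hA, hB,
              Finset.mem_filter, Finset.mem_univ, true_and]
            by_cases hy : heavy x' y
            · exact Or.inl ⟨⟨hp.1, hy⟩, hp.2.1, hh.mp hy⟩
            · exact Or.inr ⟨hp.1, hp.2.1, hp.2.2, not_le.mp hy, not_le.mp (hh.not.mp hy)⟩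
          · rintro ⟨x', y, z⟩ hp ⟨x'', y', z'⟩ hp' hh
            simp only [Finset.coe_filter, Set.mem_ofPred_eq] at hp hp' hh
            rw [hp.2, hp'.2, hh]
      -- At most `k ^ 2` pairs are heavy on both sides and at most `8 * k ^ 2` are light on both
      -- sides.
      _ ≤ A.card * A.card + B.card := by
          simpa [Finset.card_product] using Finset.card_union_le (A ×ˢ A) B
      _ ≤ 9 * k ^ 2 := by nlinarith
  let rot : V × V × V → V × V × V := fun p => (p.2.1, p.2.2, p.1)
  have hsub : (Finset.univ.filter fun p : V × V × V => G.Adj p.1 p.2.1 ∧ G.Adj p.1 p.2.2 ∧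
      G.Adj p.2.1 p.2.2) ⊆ S ∪ (S.image rot ∪ (S.image rot).image rot) := by
    rintro ⟨x, y, z⟩ hp
    simp only [Finset.mem_filter, Finset.mem_univ, true_and] at hp
    have h1 := heavy_comm x y
    have h2 := heavy_comm y z
    have h3 := heavy_comm z x
    have key : (heavy x y ↔ heavy x z) ∨ (heavy y z ↔ heavy y x) ∨ (heavy z x ↔ heavy z y) := by
      rw [← h1, h3, ← h2]
      exact iff_or_iff_or_iff _ _ _
    rw [Finset.mem_union, Finset.mem_union]
    rcases key with hk | hk | hk
    · left
      simp only [hS, Finset.mem_filter, Finset.mem_univ, true_and]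
      exact ⟨hp, hk⟩
    · right; right
      refine Finset.mem_image.mpr ⟨(z, x, y), Finset.mem_image.mpr ⟨(y, z, x), ?_, rfl⟩, rfl⟩
      simp only [hS, Finset.mem_filter, Finset.mem_univ, true_and]
      exact ⟨⟨hp.2.2, hp.1.symm, hp.2.1.symm⟩, hk⟩
    · right; left
      refine Finset.mem_image.mpr ⟨(z, x, y), ?_, rfl⟩
      simp only [hS, Finset.mem_filter, Finset.mem_univ, true_and]
      exact ⟨⟨hp.2.1.symm, hp.2.2.symm, hp.1⟩, hk⟩
  have c1 := Finset.card_le_card hsub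
  have c2 := Finset.card_union_le S (S.image rot ∪ (S.image rot).image rot)
  have c3 := Finset.card_union_le (S.image rot) ((S.image rot).image rot)
  have c4 : (S.image rot).card ≤ S.card := Finset.card_image_le
  have c5 : ((S.image rot).image rot).card ≤ (S.image rot).card := Finset.card_image_le
  have : 27 * k ^ 2 * Fintype.card V = 3 * (9 * k ^ 2 * Fintype.card V) := by ring
  omega

theorem card_ordered_triangles_le_of_degree_le {r : ℕ} (h : ∀ x, G.degree x ≤ r) :
    (Finset.univ.filter fun p : V × V × V => G.Adj p.1 p.2.1 ∧ G.Adj p.1 p.2.2 ∧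
      G.Adj p.2.1 p.2.2).card ≤ r ^ 2 * Fintype.card V := by
  set T := Finset.univ.filter fun p : V × V × V => G.Adj p.1 p.2.1 ∧ G.Adj p.1 p.2.2 ∧
      G.Adj p.2.1 p.2.2 with hT
  have hmaps : ∀ p ∈ T, p.1 ∈ (Finset.univ : Finset V) := fun _ _ => Finset.mem_univ _
  refine Finset.card_le_mul_card_image_of_maps_to hmaps _ fun x _ => ?_
  calc (T.filter fun p => p.1 = x).card
      ≤ (G.neighborFinset x ×ˢ G.neighborFinset x).card := by
        refine Finset.card_le_card_of_injOn Prod.snd ?_ ?_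
        · rintro ⟨x', y, z⟩ hp
          simp only [hT, Finset.coe_filter, Finset.mem_filter, Finset.mem_univ, true_and,
            Set.mem_ofPred_eq] at hp
          obtain ⟨hp, rfl⟩ := hp
          simp [hp.1, hp.2.1]
        · rintro ⟨x', y, z⟩ hp ⟨x'', y', z'⟩ hp' hh
          simp only [Finset.coe_filter, Set.mem_ofPred_eq] at hp hp' hh
          rw [hp.2, hp'.2, hh]
    _ ≤ r ^ 2 := by
        rw [Finset.card_product, card_neighborFinset_eq_degree, sq]
        exact Nat.mul_le_mul (h x) (h x)

end Count

/-! ### Embedding extended friendship graphs, and the upper bound -/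

/-- Greedy extension of an embedding of a rooted tree, given by its parent function, from a
subset closed under taking parents. -/
theorem exists_greedy_extension {V W : Type*} [Fintype V] [DecidableEq V] [Fintype W]
    [DecidableEq W] {G : SimpleGraph V} [DecidableRel G.Adj]
    (hdeg : ∀ x, Fintype.card W ≤ G.degree x) (v : W) (p : W → W) (d : W → ℕ)
    (hd : ∀ w, w ≠ v → d (p w) < d w) (n : ℕ) :
    ∀ (A : Finset W) (f : W → V), Aᶜ.card = n → v ∈ A → (∀ w ∈ A, w ≠ v → p w ∈ A) →
      Set.InjOn f A → (∀ w ∈ A, w ≠ v → G.Adj (f (p w)) (f w)) →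
      ∃ g : W → V, Function.Injective g ∧ (∀ w ∈ A, g w = f w) ∧
        ∀ w, w ≠ v → G.Adj (g (p w)) (g w) := by
  induction n with
  | zero =>
    intro A f hA _ _ hf hadj
    have hA' : ∀ w, w ∈ A := by simpa [Finset.eq_univ_iff_forall] using hA
    exact ⟨f, fun a b hab => hf (hA' a) (hA' b) hab, fun _ _ => rfl,
      fun w hw => hadj w (hA' w) hw⟩
  | succ n ih =>
    intro A f hA hv hcl hf hadj
    -- A missing vertex of least depth has its parent already placed.
    obtain ⟨w, hw, hmin⟩ := Finset.exists_min_image Aᶜ d (Finset.card_pos.mp (by omega))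
    have hwA : w ∉ A := Finset.mem_compl.mp hw
    have hwv : w ≠ v := fun h => hwA (h ▸ hv)
    have hpw : p w ∈ A := by
      by_contra h
      exact absurd (hmin _ (Finset.mem_compl.mpr h)) (not_le.mpr (hd w hwv))
    obtain ⟨y, hy, hyA⟩ : ∃ y ∈ G.neighborFinset (f (p w)), y ∉ A.image f := by
      apply Finset.exists_mem_notMem_of_card_lt_card
      rw [card_neighborFinset_eq_degree]
      refine lt_of_le_of_lt Finset.card_image_le (lt_of_lt_of_le ?_ (hdeg _))
      exact (Finset.card_lt_iff_ne_univ A).mpr fun h => hwA (h ▸ Finset.mem_univ w)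
    rw [mem_neighborFinset] at hy
    have hne : ∀ a ∈ A, a ≠ w := fun a ha h => hwA (h ▸ ha)
    have hup : ∀ a ∈ A, Function.update f w y a = f a := fun a ha =>
      Function.update_of_ne (hne a ha) _ _
    obtain ⟨g, hg, hgA, hgadj⟩ := ih (insert w A) (Function.update f w y)
      (by rw [Finset.compl_insert, Finset.card_erase_of_mem hw]; omega)
      (Finset.mem_insert_of_mem hv)
      (by
        intro u hu huv
        rcases Finset.mem_insert.mp hu with rfl | hu
        · exact Finset.mem_insert_of_mem hpw
        · exact Finset.mem_insert_of_mem (hcl u hu huv))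
      (by
        rw [Finset.coe_insert, Set.injOn_insert (by simpa using hwA)]
        refine ⟨fun a ha b hb hab => ?_, ?_⟩
        · rw [hup a ha, hup b hb] at hab
          exact hf ha hb hab
        · rintro ⟨a, ha, hay⟩
          rw [hup a ha, Function.update_self] at hay
          exact hyA (Finset.mem_image.mpr ⟨a, ha, hay⟩))
      (by
        intro u hu huv
        rcases Finset.mem_insert.mp hu with rfl | hu
        · rw [hup _ hpw, Function.update_self]
          exact hy
        · rw [hup _ hu, hup _ (hcl u hu huv)]
          exact hadj u hu huv)
    exact ⟨g, hg, fun a ha => (hgA a (Finset.mem_insert_of_mem ha)).trans (hup a ha), hgadj⟩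

/-- The parent is the penultimate vertex of a shortest path from `v`. The ends of an edge differ by
one in depth, and uniqueness of paths makes the shallower end the parent of the other. -/
theorem IsTree.exists_parent {W : Type*} {T : SimpleGraph W} (hT : T.IsTree) (v : W) :
    ∃ p : W → W, (∀ w, w ≠ v → T.dist v (p w) < T.dist v w) ∧
      ∀ u w, T.Adj u w → (u ≠ v ∧ p u = w) ∨ (w ≠ v ∧ p w = u) := by
  classical
  choose q hq using fun w => hT.connected.exists_path_of_dist v w
  have key : ∀ u w, T.Adj u w → T.dist v w = T.dist v u + 1 →
      w ≠ v ∧ (q w).penultimate = u := by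
    intro u w huw hd
    refine ⟨fun h => by simp [h] at hd, ?_⟩
    have hw : w ∉ (q u).support := by
      intro hw
      have := dist_le ((q u).takeUntil w hw)
      have := (q u).length_takeUntil_le_length hw
      have := (hq u).2
      omega
    have hp := (hq u).1.concat hw huw
    have : q w = (q u).concat huw :=
      Subtype.mk.inj <| hT.isAcyclic.subsingleton_path v w |>.elim ⟨q w, (hq w).1⟩ ⟨_, hp⟩
    rw [this, Walk.penultimate_concat]
  refine ⟨fun w => (q w).penultimate, fun w hw => ?_, fun u w huw => ?_⟩
  · have hnil : ¬ (q w).Nil := fun h => hw h.eq.symm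
    have hadj := (q w).adj_penultimate hnil
    have hle := dist_le (q w).dropLast
    have h1 := (q w).length_dropLast_add_one hnil
    have h2 := (hq w).2
    change T.dist v (q w).penultimate < _
    omega
  · rcases hT.dist_eq_dist_add_one_of_adj v huw with h | h
    · exact Or.inl (key w u huw.symm h)
    · exact Or.inr (key u w huw h)

/-- An extended friendship graph is contained in every graph of large minimum degree that contains
a large windmill. -/
theorem IsExtendedFriendship.isContained {V W : Type*} [Fintype V] [Fintype W]
    {F : SimpleGraph W} (hF : F.IsExtendedFriendship) {G : SimpleGraph V} [DecidableRel G.Adj]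
    (hdeg : ∀ x, Fintype.card W ≤ G.degree x) {x : V} (hx : G.HasWindmill x (Fintype.card W)) :
    F.IsContained G := by
  classical
  obtain ⟨hcyc, v, hv⟩ := hF
  let e := Fintype.equivFin W
  obtain ⟨a, b, ha, hb, hab, hadj⟩ := hx
  -- the edges opposite to the centre form a matching, and without them `F` is a forest
  let M : W → W → Prop := fun y z => F.Adj v y ∧ F.Adj v z ∧ F.Adj y z
  have hMsymm : ∀ {y z}, M y z → M z y := fun h => ⟨h.2.1, h.1, h.2.2.symm⟩
  have hMuniq : ∀ {y z z'}, M y z → M y z' → z = z' := by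
    intro y z z' h h'
    by_contra hne
    -- Two edges of `M` at `y` would close a 4-cycle through `v`.
    let c : F.Walk v v := .cons h.2.1 (.cons h.2.2.symm (.cons h'.2.2 (.cons h'.2.1.symm .nil)))
    have hc : c.IsCycle := by
      rw [Walk.cons_isCycle_iff]
      simp [Walk.cons_isPath_iff, h.1.ne, h.1.ne', h.2.1.ne, h.2.1.ne', h.2.2.ne',
        h'.2.1.ne, h'.2.1.ne', h'.2.2.ne, hne]
    have := hcyc v c hc
    simp [c] at this
  let T₀ : SimpleGraph W :=
    { Adj := fun y z => F.Adj y z ∧ ¬ M y z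
      symm := ⟨fun y z h => ⟨h.1.symm, fun hm => h.2 (hMsymm hm)⟩⟩
      loopless := ⟨fun y h => h.1.ne rfl⟩ }
  have hT₀F : T₀ ≤ F := fun y z h => h.1
  have hT₀ : T₀.IsAcyclic := by
    intro u c hc
    have h3 := hcyc u (c.mapLe hT₀F) (hc.mapLe hT₀F)
    rw [Walk.length_mapLe] at h3
    obtain ⟨s, hs⟩ := is3Clique_iff_exists_cycle_length_three.mpr ⟨u, c, hc, h3⟩
    have hvs := hv s (hs.mono hT₀F)
    obtain ⟨y, z, t, hyz, hyt, hzt, rfl⟩ := is3Clique_iff.mp hs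
    simp only [Finset.mem_insert, Finset.mem_singleton] at hvs
    rcases hvs with rfl | rfl | rfl
    · exact hzt.2 ⟨hyz.1, hyt.1, hzt.1⟩
    · exact hyt.2 ⟨hyz.1.symm, hzt.1, hyt.1⟩
    · exact hyz.2 ⟨hyt.1.symm, hzt.1.symm, hyz.1⟩
  have : Nonempty W := ⟨v⟩
  -- `F` may be disconnected, so the forest is completed to a spanning tree of the complete graph on
  -- `W`; the additional edges can be embedded too.
  obtain ⟨T, hT₀T, -, hT⟩ :=
    (connected_top (V := W)).exists_isTree_le_of_le_of_isAcyclic le_top hT₀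
  obtain ⟨p, hpd, hp⟩ := hT.exists_parent v
  let P : W → Prop := fun y => ∃ z, M y z
  have hvP : ¬ P v := fun ⟨z, hz⟩ => hz.1.ne rfl
  have hpP : ∀ y, P y → p y = v := by
    intro y hy
    have hvy : T.Adj v y := by
      obtain ⟨z, hz⟩ := hy
      exact hT₀T ⟨hz.1, fun hm => hm.1.ne rfl⟩
    rcases hp v y hvy with h | h
    · exact absurd rfl h.1
    · exact h.2
  choose σ hσ using fun y : {y // P y} => y.2
  -- An edge of `M` goes to the blade indexed by its smaller end, with that end at `a` and the
  -- larger at `b`. Thus `|W|` blades suffice and distinct edges use distinct blades.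
  let f : W → V := fun y =>
    if h : P y then
      if e y < e (σ ⟨y, h⟩) then a (e y) else b (e (σ ⟨y, h⟩))
    else x
  have hfv : f v = x := dif_neg hvP
  have hfP : ∀ y z, M y z → f y = if e y < e z then a (e y) else b (e z) := by
    intro y z hyz
    have hy : P y := ⟨z, hyz⟩
    have : σ ⟨y, hy⟩ = z := hMuniq (hσ ⟨y, hy⟩) hyz
    simp only [f, dif_pos hy, this]
  have hfx : ∀ y, P y → G.Adj x (f y) := by
    rintro y ⟨z, hz⟩
    rw [hfP y z hz]
    split_ifs
    · exact (hadj _).1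
    · exact (hadj _).2.1
  have hfM : ∀ y z, M y z → G.Adj (f y) (f z) := by
    intro y z hyz
    rw [hfP y z hyz, hfP z y (hMsymm hyz)]
    have hne : e y ≠ e z := fun h => hyz.2.2.ne (e.injective h)
    rcases lt_or_gt_of_ne hne with h | h
    · rw [if_pos h, if_neg h.asymm]
      exact (hadj _).2.2
    · rw [if_neg h.asymm, if_pos h]
      exact (hadj _).2.2.symm
  have hfinj : ∀ y y', P y → P y' → f y = f y' → y = y' := by
    rintro y y' ⟨z, hz⟩ ⟨z', hz'⟩ h
    rw [hfP y z hz, hfP y' z' hz'] at h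
    split_ifs at h
    · exact e.injective (ha h)
    · exact absurd h (hab _ _)
    · exact absurd h.symm (hab _ _)
    · have hzz : z = z' := e.injective (hb h)
      subst hzz
      exact hMuniq (hMsymm hz) (hMsymm hz')
  obtain ⟨g, hg, hgA, hgadj⟩ := exists_greedy_extension hdeg v p (fun w => T.dist v w) hpd _
    (Finset.univ.filter fun y => y = v ∨ P y) f rfl (by simp)
    (by
      intro w hw hwv
      have hw : P w := by simpa [hwv] using hw
      simp [hpP w hw])
    (by
      intro y hy z hz hyz
      have hy : y = v ∨ P y := by simpa using hy
      have hz : z = v ∨ P z := by simpa using hz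
      rcases hy with rfl | hy <;> rcases hz with rfl | hz
      · rfl
      · rw [hfv] at hyz
        exact absurd hyz (hfx z hz).ne
      · rw [hfv] at hyz
        exact absurd hyz (hfx y hy).ne'
      · exact hfinj y z hy hz hyz)
    (by
      intro w hw hwv
      have hw : P w := by simpa [hwv] using hw
      rw [hpP w hw, hfv]
      exact hfx w hw)
  refine ⟨⟨⟨g, fun {y z} hyz => ?_⟩, hg⟩⟩
  by_cases hm : M y z
  · rw [hgA y (by simpa using Or.inr ⟨z, hm⟩), hgA z (by simpa using Or.inr ⟨y, hMsymm hm⟩)]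
    exact hfM y z hm
  · rcases hp y z (hT₀T ⟨hyz, hm⟩) with ⟨h, rfl⟩ | ⟨h, rfl⟩
    · exact (hgadj y h).symm
    · exact hgadj z h

theorem IsExtendedFriendship.rex_triangle_le {W : Type*} [Fintype W] {F : SimpleGraph W}
    (hF : F.IsExtendedFriendship) (n : ℕ) :
    rex n (completeGraph (Fin 3)) F ≤ 27 * Fintype.card W ^ 2 * n := by
  classical
  rw [rex]
  refine Finset.sup_le fun G hG => ?_
  obtain ⟨hfree, r, hr⟩ := (Finset.mem_filter.mp hG).2
  refine G.copyCount_triangle_le.trans ?_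
  by_cases hrW : Fintype.card W ≤ r
  · have := G.card_ordered_triangles_le (k := Fintype.card W) fun x hx =>
      hfree (hF.isContained (fun y => by
        convert hrW using 1
        exact hr y) hx)
    simpa using this
  · have := G.card_ordered_triangles_le_of_degree_le (r := Fintype.card W) fun x => by
      rw [show G.degree x = r by convert hr x]
      omega
    rw [Fintype.card_fin] at this
    refine this.trans (Nat.mul_le_mul_right _ ?_)
    omega

/-! ### Lower bounds for `rex` from explicit graphs -/

theorem card_le_copyCount {V U : Type*} [Fintype V] {G : SimpleGraph V} {H : SimpleGraph U}
    (S : Finset G.Subgraph) (hS : ∀ G' ∈ S, Nonempty (H ≃g G'.coe)) :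
    S.card ≤ G.copyCount H := by
  have key : ∀ (_ : Fintype G.Subgraph)
      (_ : DecidablePred fun G' : G.Subgraph => Nonempty (H ≃g G'.coe)),
      S.card ≤ (Finset.univ.filter fun G' : G.Subgraph => Nonempty (H ≃g G'.coe)).card :=
    fun _ _ => Finset.card_le_card fun G' h => (Finset.mem_filter_univ G').mpr (hS G' h)
  rw [copyCount]
  exact key _ _

/-- A regular `F`-free graph bounds `rex` from below by its number of triangles. -/
theorem card_triangles_le_rex {V W : Type*} [Fintype V] {F : SimpleGraph W} (G : SimpleGraph V)
    [DecidableRel G.Adj] {r : ℕ} (hr : G.IsRegularOfDegree r) (hF : F.Free G)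
    (T : Finset (Finset V)) (hT : ∀ t ∈ T, G.IsNClique 3 t) :
    T.card ≤ rex (Fintype.card V) (completeGraph (Fin 3)) F := by
  classical
  let e := G.overFinIso (rfl : Fintype.card V = Fintype.card V)
  let G' := G.overFin (rfl : Fintype.card V = Fintype.card V)
  let f : V ↪ Fin (Fintype.card V) := e.toEquiv.toEmbedding
  have hmem : G' ∈ (Finset.univ.filter fun G : SimpleGraph (Fin (Fintype.card V)) =>
      F.Free G ∧ ∃ r : ℕ, G.IsRegularOfDegree r) := by
    refine Finset.mem_filter.mpr ⟨Finset.mem_univ _, ?_, r, fun x => ?_⟩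
    · exact (free_congr_right e).mp hF
    · rw [← hr (e.symm x), ← e.symm.degree_eq]
  refine le_trans ?_ (Finset.le_sup (f := fun G => G.copyCount (completeGraph (Fin 3))) hmem)
  have hT' : ∀ t ∈ T, G'.IsNClique 3 (t.map f) := by
    intro t ht
    obtain ⟨x, y, z, hxy, hxz, hyz, rfl⟩ := is3Clique_iff.mp (hT t ht)
    refine is3Clique_iff.mpr ⟨e x, e y, e z, e.map_adj_iff.mpr hxy, e.map_adj_iff.mpr hxz,
      e.map_adj_iff.mpr hyz, ?_⟩
    ext u
    simp [f]
  let ψ : Finset V → G'.Subgraph := fun t =>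
    (⊤ : G'.Subgraph).induce ((t.map f : Finset (Fin (Fintype.card V))) : Set _)
  have hψ : Function.Injective ψ := by
    intro s t hst
    have h : ((s.map f : Finset (Fin (Fintype.card V))) : Set (Fin (Fintype.card V))) =
      ((t.map f : Finset (Fin (Fintype.card V))) : Set (Fin (Fintype.card V))) :=
        congrArg Subgraph.verts hst
    exact Finset.map_injective f (Finset.coe_injective h)
  rw [← Finset.card_image_of_injective T hψ]
  refine card_le_copyCount _ fun K hK => ?_
  obtain ⟨t, ht, rfl⟩ := Finset.mem_image.mp hK
  have hc := hT' t ht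
  have hcard : Fintype.card (t.map f : Finset (Fin (Fintype.card V))) = 3 := by
    rw [Fintype.card_coe, hc.card_eq]
  refine ⟨⟨(Fintype.equivFinOfCardEq hcard).symm, ?_⟩⟩
  intro i j
  set φ := (Fintype.equivFinOfCardEq hcard).symm
  change (_ ∧ _ ∧ G'.Adj (φ i) (φ j)) ↔ i ≠ j
  constructor
  · rintro ⟨-, -, h⟩ rfl
    exact h.ne rfl
  · intro hij
    exact ⟨(φ i).2, (φ j).2, hc.isClique (φ i).2 (φ j).2
      fun h => hij (φ.injective (Subtype.ext h))⟩

theorem not_isBigO_rex_of_forall_exists {U W : Type*} {H : SimpleGraph U} {F : SimpleGraph W}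
    (h : ∀ C : ℕ, ∃ n ≥ C, C * n < rex n H F) :
    ¬ ((fun n : ℕ => (rex n H F : ℝ)) =O[atTop] fun n : ℕ => (n : ℝ)) := by
  intro hO
  obtain ⟨c, hc⟩ := hO.bound
  obtain ⟨N, hN⟩ := eventually_atTop.mp hc
  obtain ⟨C, hC⟩ := exists_nat_ge (max c N)
  obtain ⟨n, hn, hlt⟩ := h C
  have hNn : N ≤ n := by
    have : (N : ℝ) ≤ C := (le_max_right _ _).trans hC
    exact le_trans (by exact_mod_cast this) hn
  have h1 := hN n hNn
  rw [Real.norm_natCast, Real.norm_natCast] at h1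
  have h2 : (C : ℝ) * n < rex n H F := by exact_mod_cast hlt
  have h3 : c * n ≤ (C : ℝ) * n :=
    mul_le_mul_of_nonneg_right ((le_max_left _ _).trans hC) (Nat.cast_nonneg n)
  linarith

/-! ### Triangles without a common vertex: the cone graph -/

/-- The adjacency relation of the bipartite part of `coneGraph`: two vertices `(s, i)`, `(t, j)`
on different sides, without the perfect matching between the first `m` vertices of each side. -/
def ConeAdj (m : ℕ) (p q : Bool × Bool × Fin m) : Prop :=
  p.1 ≠ q.1 ∧ ¬ (p.2.1 = true ∧ q.2.1 = true ∧ p.2.2 = q.2.2)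

/-- A `2m`-regular graph with a quadratic number of triangles that all share the vertex `none`:
`K_{2m,2m}` with a matching of size `m` removed, and the vertices of the matching joined to a new
vertex. -/
def coneGraph (m : ℕ) : SimpleGraph (Option (Bool × Bool × Fin m)) where
  Adj
    | none, none => False
    | none, some p => p.2.1 = true
    | some p, none => p.2.1 = true
    | some p, some q => ConeAdj m p q
  symm := ⟨by
    rintro (_ | p) (_ | q) h
    · exact h
    · exact h
    · exact h
    · exact ⟨h.1.symm, fun h' => h.2 ⟨h'.2.1, h'.1, h'.2.2.symm⟩⟩⟩
  loopless := ⟨by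
    rintro (_ | p) h
    · exact h
    · exact h.1 rfl⟩

noncomputable instance (m : ℕ) : DecidableRel (coneGraph m).Adj := Classical.decRel _

theorem coneGraph_isRegularOfDegree (m : ℕ) : (coneGraph m).IsRegularOfDegree (2 * m) := by
  classical
  rintro (_ | ⟨s, c, i⟩)
  · have : (coneGraph m).neighborFinset none =
        (Finset.univ : Finset (Bool × Fin m)).image fun x => some (x.1, true, x.2) := by
      ext (_ | ⟨t, d, j⟩)
      · rw [mem_neighborFinset]
        simp
      · rw [mem_neighborFinset]
        change d = true ↔ _
        simp [eq_comm]
    rw [← card_neighborFinset_eq_degree, this, Finset.card_image_of_injective]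
    · simp
    · rintro ⟨t, j⟩ ⟨t', j'⟩ h
      simpa using h
  · -- the neighbour `none` of a matched vertex replaces its partner
    have : (coneGraph m).neighborFinset (some (s, c, i)) =
        (Finset.univ : Finset (Bool × Fin m)).image fun x =>
          if c = true ∧ x.1 = true ∧ x.2 = i then none else some (!s, x.1, x.2) := by
      ext (_ | ⟨t, d, j⟩)
      · simp only [mem_neighborFinset, Finset.mem_image, Finset.mem_univ, true_and]
        constructor
        · intro h
          have hc : c = true := h
          exact ⟨(true, i), by simp [hc]⟩
        · rintro ⟨⟨d', j'⟩, h⟩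
          split_ifs at h with h'
          exact h'.1
      · simp only [mem_neighborFinset, Finset.mem_image, Finset.mem_univ, true_and]
        constructor
        · intro h
          have h : ConeAdj m (s, c, i) (t, d, j) := h
          refine ⟨(d, j), ?_⟩
          rw [if_neg fun h' => h.2 ⟨h'.1, h'.2.1, h'.2.2.symm⟩]
          have : (!s) = t := by
            have := h.1
            revert this
            cases s <;> cases t <;> simp
          rw [this]
        · rintro ⟨⟨d', j'⟩, h⟩
          split_ifs at h with h'
          simp only [Option.some.injEq, Prod.mk.injEq] at h
          obtain ⟨rfl, rfl, rfl⟩ := h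
          refine ⟨by cases s <;> simp, fun h'' => h' ⟨h''.1, h''.2.1, h''.2.2.symm⟩⟩
    rw [← card_neighborFinset_eq_degree, this, Finset.card_image_of_injective]
    · simp
    · rintro ⟨d, j⟩ ⟨d', j'⟩ h
      dsimp only at h
      split_ifs at h with h1 h2
      · rw [h1.2.1, h1.2.2, h2.2.1, h2.2.2]
      · simpa using h

/-- Without `none` the graph is bipartite, with the first coordinate as the side. -/
theorem none_mem_of_isNClique_coneGraph {m : ℕ} {t : Finset (Option (Bool × Bool × Fin m))}
    (ht : (coneGraph m).IsNClique 3 t) : none ∈ t := by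
  classical
  obtain ⟨x, y, z, hxy, hxz, hyz, rfl⟩ := is3Clique_iff.mp ht
  rcases x with _ | x
  · simp
  rcases y with _ | y
  · simp
  rcases z with _ | z
  · simp
  have h1 : x.1 ≠ y.1 := hxy.1
  have h2 : x.1 ≠ z.1 := hxz.1
  have h3 : y.1 ≠ z.1 := hyz.1
  revert h1 h2 h3
  cases x.1 <;> cases y.1 <;> cases z.1 <;> simp

/-- An embedded `F` would have the preimage of `none` in all its triangles; if there is no preimage,
`F` has no triangle and any vertex is common. The `m ^ 2 - m` triangles come from matched vertices
on opposite sides that are not partners. -/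
theorem le_rex_of_not_common_vertex {W : Type*} [Nonempty W] {F : SimpleGraph W}
    (hF : ¬ ∃ v : W, ∀ t : Finset W, F.IsNClique 3 t → v ∈ t) (m : ℕ) :
    m ^ 2 - m ≤ rex (4 * m + 1) (completeGraph (Fin 3)) F := by
  classical
  have hfree : F.Free (coneGraph m) := by
    rintro ⟨f⟩
    apply hF
    have hmap : ∀ t : Finset W, F.IsNClique 3 t → ∃ w ∈ t, f w = none := by
      intro t ht
      obtain ⟨x, y, z, hxy, hxz, hyz, rfl⟩ := is3Clique_iff.mp ht
      have := none_mem_of_isNClique_coneGraph (is3Clique_iff.mpr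
        ⟨f x, f y, f z, f.toHom.map_adj hxy, f.toHom.map_adj hxz, f.toHom.map_adj hyz, rfl⟩)
      simpa [eq_comm] using this
    by_cases h : ∃ w, f w = none
    · obtain ⟨w, hw⟩ := h
      refine ⟨w, fun t ht => ?_⟩
      obtain ⟨w', hw', h'⟩ := hmap t ht
      exact f.injective (hw.trans h'.symm) ▸ hw'
    · refine ⟨Classical.arbitrary W, fun t ht => ?_⟩
      obtain ⟨w', _, h'⟩ := hmap t ht
      exact absurd ⟨w', h'⟩ h
  let tri : Fin m × Fin m → Finset (Option (Bool × Bool × Fin m)) := fun x =>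
    {none, some (false, true, x.1), some (true, true, x.2)}
  have hle := card_triangles_le_rex (coneGraph m) (coneGraph_isRegularOfDegree m) hfree
    ((Finset.univ : Finset (Fin m)).offDiag.image tri) (by
      intro t ht
      obtain ⟨⟨i, j⟩, hij, rfl⟩ := Finset.mem_image.mp ht
      have hij : i ≠ j := by simpa using hij
      have hadj : ConeAdj m (false, true, i) (true, true, j) := ⟨by simp, fun h => hij h.2.2⟩
      exact is3Clique_iff.mpr ⟨none, some (false, true, i), some (true, true, j),
        (rfl : true = true), (rfl : true = true), hadj, rfl⟩)
  rw [Finset.card_image_of_injective, Finset.offDiag_card] at hle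
  · have hcard : Fintype.card (Option (Bool × Bool × Fin m)) = 4 * m + 1 := by
      simp
      ring
    rw [hcard] at hle
    simpa [sq] using hle
  · rintro ⟨i, j⟩ ⟨i', j'⟩ h
    have h1 : some (false, true, i) ∈ tri (i', j') := h ▸ (by simp [tri])
    have h2 : some (true, true, j) ∈ tri (i', j') := h ▸ (by simp [tri])
    simp only [tri, Finset.mem_insert, Finset.mem_singleton] at h1 h2
    simp at h1 h2
    rw [h1, h2]

theorem not_isBigO_rex_of_not_common_vertex {W : Type*} [Nonempty W] {F : SimpleGraph W}
    (hF : ¬ ∃ v : W, ∀ t : Finset W, F.IsNClique 3 t → v ∈ t) :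
    ¬ ((fun n : ℕ => (rex n (completeGraph (Fin 3)) F : ℝ)) =O[atTop] fun n : ℕ => (n : ℝ)) := by
  refine not_isBigO_rex_of_forall_exists fun C => ⟨4 * (5 * C + 2) + 1, by omega, ?_⟩
  refine lt_of_lt_of_le ?_ (le_rex_of_not_common_vertex hF (5 * C + 2))
  have : (5 * C + 2) ^ 2 = (5 * C + 2) * (5 * C + 1) + (5 * C + 2) := by ring
  rw [this, Nat.add_sub_cancel]
  nlinarith

/-! ### Generators of order three acting on truncated words -/

/-- Reduced words of length at most `ℓ` in the free product of copies of `ℤ/3ℤ` indexed by `I`.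
The letter `(i, false)` stands for the generator of the `i`-th factor, and `(i, true)` for its
square. -/
abbrev ReducedWord (I : Type*) (ℓ : ℕ) : Type _ :=
  {l : List (I × Bool) // l.IsChain (fun a b => a.1 ≠ b.1) ∧ l.length ≤ ℓ}

instance (I : Type*) [Finite I] (ℓ : ℕ) : Finite (ReducedWord I ℓ) :=
  ((List.finite_length_le (I × Bool) ℓ).subset fun _ h => h.2).to_subtype

/-- Left multiplication by the `i`-th generator on words, truncated at length `ℓ`. -/
def rotateWord {I : Type*} [DecidableEq I] (ℓ : ℕ) (i : I) : List (I × Bool) → List (I × Bool)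
  | [] => if 0 < ℓ then [(i, false)] else []
  | (j, b) :: y =>
    if i = j then (if b then y else (i, true) :: y)
    else if y.length + 1 < ℓ then (i, false) :: (j, b) :: y else (j, b) :: y

section Words

variable {I : Type*} [DecidableEq I] {ℓ : ℕ}

theorem rotateWord_same_false (i : I) (y : List (I × Bool)) :
    rotateWord ℓ i ((i, false) :: y) = (i, true) :: y := by
  simp [rotateWord]

theorem rotateWord_same_true (i : I) (y : List (I × Bool)) :
    rotateWord ℓ i ((i, true) :: y) = y := by
  simp [rotateWord]

theorem rotateWord_of_lt (i : I) (y : List (I × Bool)) (hy : ∀ a ∈ y.head?, i ≠ a.1)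
    (hl : y.length < ℓ) : rotateWord ℓ i y = (i, false) :: y := by
  rcases y with _ | ⟨⟨j, b⟩, y⟩
  · exact if_pos hl
  · have hij : i ≠ j := by simpa using hy
    have hl' : y.length + 1 < ℓ := by simpa using hl
    simp [rotateWord, hij, hl']

theorem rotateWord_of_le (i : I) (y : List (I × Bool)) (hy : ∀ a ∈ y.head?, i ≠ a.1)
    (hl : ℓ ≤ y.length) : rotateWord ℓ i y = y := by
  rcases y with _ | ⟨⟨j, b⟩, y⟩
  · have : ℓ = 0 := by simpa using hl
    simp [rotateWord, this]
  · have hij : i ≠ j := by simpa using hy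
    have hl' : ¬ (y.length + 1 < ℓ) := by simpa using hl
    simp [rotateWord, hij, hl']

theorem rotateWord_cases (i : I) (l : List (I × Bool)) (hl : l.IsChain fun a b => a.1 ≠ b.1) :
    (∃ y, (∀ a ∈ y.head?, i ≠ a.1) ∧ (l = (i, false) :: y ∨ l = (i, true) :: y)) ∨
      ∀ a ∈ l.head?, i ≠ a.1 := by
  rcases l with _ | ⟨⟨j, b⟩, y⟩
  · simp
  · by_cases hij : i = j
    · subst hij
      refine Or.inl ⟨y, (List.isChain_cons.mp hl).1, ?_⟩
      cases b <;> simp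
    · exact Or.inr (by simpa using hij)

theorem rotateWord_mem (i : I) (l : List (I × Bool))
    (hl : l.IsChain (fun a b => a.1 ≠ b.1) ∧ l.length ≤ ℓ) :
    (rotateWord ℓ i l).IsChain (fun a b => a.1 ≠ b.1) ∧ (rotateWord ℓ i l).length ≤ ℓ := by
  rcases rotateWord_cases i l hl.1 with ⟨y, hy, rfl | rfl⟩ | hy
  · rw [rotateWord_same_false]
    rw [List.isChain_cons] at hl ⊢
    exact hl
  · rw [rotateWord_same_true]
    rw [List.isChain_cons] at hl
    exact ⟨hl.1.2, (Nat.le_succ _).trans hl.2⟩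
  · rcases lt_or_ge l.length ℓ with h | h
    · rw [rotateWord_of_lt i l hy h, List.isChain_cons]
      exact ⟨⟨hy, hl.1⟩, h⟩
    · rw [rotateWord_of_le i l hy h]
      exact hl

/-- The orbits are triples `y`, `(i, false) :: y`, `(i, true) :: y` with `y` shorter than `ℓ`, and
fixed points of length `ℓ`. Both longer words have the same length, so truncation never cuts an
orbit. -/
theorem rotateWord_rotateWord_rotateWord (i : I) (l : List (I × Bool))
    (hl : l.IsChain (fun a b => a.1 ≠ b.1) ∧ l.length ≤ ℓ) :
    rotateWord ℓ i (rotateWord ℓ i (rotateWord ℓ i l)) = l := by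
  rcases rotateWord_cases i l hl.1 with ⟨y, hy, rfl | rfl⟩ | hy
  · rw [rotateWord_same_false, rotateWord_same_true, rotateWord_of_lt i y hy hl.2]
  · rw [rotateWord_same_true, rotateWord_of_lt i y hy hl.2, rotateWord_same_false]
  · rcases lt_or_ge l.length ℓ with h | h
    · rw [rotateWord_of_lt i l hy h, rotateWord_same_false, rotateWord_same_true]
    · rw [rotateWord_of_le i l hy h, rotateWord_of_le i l hy h, rotateWord_of_le i l hy h]

variable (ℓ) in
/-- The permutation of the reduced words of length at most `ℓ` by which the `i`-th generator
acts. -/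
def wordPerm (i : I) : Equiv.Perm (ReducedWord I ℓ) where
  toFun l := ⟨rotateWord ℓ i l.1, rotateWord_mem i l.1 l.2⟩
  invFun l := ⟨rotateWord ℓ i (rotateWord ℓ i l.1),
    rotateWord_mem i _ (rotateWord_mem i l.1 l.2)⟩
  left_inv l := Subtype.ext (rotateWord_rotateWord_rotateWord i l.1 l.2)
  right_inv l := Subtype.ext (rotateWord_rotateWord_rotateWord i l.1 l.2)

variable (ℓ) in
/-- The permutation by which a letter acts. -/
def letterPerm (c : I × Bool) : Equiv.Perm (ReducedWord I ℓ) :=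
  if c.2 then wordPerm ℓ c.1 * wordPerm ℓ c.1 else wordPerm ℓ c.1

theorem wordPerm_mul_mul (i : I) : wordPerm ℓ i * wordPerm ℓ i * wordPerm ℓ i = 1 := by
  ext l : 1
  exact Subtype.ext (rotateWord_rotateWord_rotateWord i l.1 l.2)

theorem letterPerm_mul_letterPerm_same (i : I) (b : Bool) :
    letterPerm ℓ (i, b) * letterPerm ℓ (i, b) = letterPerm ℓ (i, !b) := by
  have h := wordPerm_mul_mul (ℓ := ℓ) i
  cases b
  · simp [letterPerm]
  · simp [letterPerm, ← mul_assoc, h]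

theorem letterPerm_mul_letterPerm_not (i : I) (b : Bool) :
    letterPerm ℓ (i, b) * letterPerm ℓ (i, !b) = 1 := by
  have h := wordPerm_mul_mul (ℓ := ℓ) i
  cases b
  · simpa [letterPerm, ← mul_assoc] using h
  · simpa [letterPerm] using h

theorem letterPerm_apply_of_lt (c : I × Bool) (l : ReducedWord I ℓ)
    (hl : ∀ a ∈ l.1.head?, c.1 ≠ a.1) (hlt : l.1.length < ℓ) :
    (letterPerm ℓ c l).1 = c :: l.1 := by
  obtain ⟨i, b⟩ := c
  have h : rotateWord ℓ i l.1 = (i, false) :: l.1 := rotateWord_of_lt i l.1 hl hlt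
  cases b
  · exact h
  · change rotateWord ℓ i (rotateWord ℓ i l.1) = _
    rw [h, rotateWord_same_false]

end Words

/-! ### A Cayley graph with many triangles and no cycle of length `ℓ` -/

/-- The Cayley graph, on all permutations of the reduced words of length at most `ℓ`, generated by
the letters. -/
def wordCayleyGraph (I : Type*) [DecidableEq I] (ℓ : ℕ) :
    SimpleGraph (Equiv.Perm (ReducedWord I ℓ)) where
  Adj g h := g ≠ h ∧ ∃ c, h = letterPerm ℓ c * g
  symm := ⟨by
    rintro g h ⟨hne, ⟨i, b⟩, rfl⟩
    refine ⟨hne.symm, (i, !b), ?_⟩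
    have := letterPerm_mul_letterPerm_not (ℓ := ℓ) i (!b)
    rw [Bool.not_not] at this
    rw [← mul_assoc, this, one_mul]⟩
  loopless := ⟨fun _ h => h.1 rfl⟩

/-- The empty word. -/
def emptyWord (I : Type*) (ℓ : ℕ) : ReducedWord I ℓ :=
  ⟨[], List.isChain_nil, Nat.zero_le _⟩

section Cayley

variable {I : Type*} [DecidableEq I] {ℓ : ℕ}

theorem letterPerm_emptyWord (hℓ : 0 < ℓ) (c : I × Bool) :
    (letterPerm ℓ c (emptyWord I ℓ)).1 = [c] :=
  letterPerm_apply_of_lt c (emptyWord I ℓ) (by simp [emptyWord]) hℓ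

theorem letterPerm_injective (hℓ : 0 < ℓ) :
    Function.Injective (letterPerm ℓ : I × Bool → Equiv.Perm (ReducedWord I ℓ)) := by
  intro c c' h
  have h1 := letterPerm_emptyWord hℓ c
  rw [h, letterPerm_emptyWord hℓ] at h1
  simpa using h1.symm

theorem letterPerm_ne_one (hℓ : 0 < ℓ) (c : I × Bool) : letterPerm ℓ c ≠ 1 := by
  intro h
  have h1 := letterPerm_emptyWord hℓ c
  rw [h, Equiv.Perm.one_apply] at h1
  simp [emptyWord] at h1

theorem wordCayleyGraph_adj_letterPerm_mul (hℓ : 0 < ℓ) (c : I × Bool)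
    (g : Equiv.Perm (ReducedWord I ℓ)) : (wordCayleyGraph I ℓ).Adj g (letterPerm ℓ c * g) :=
  ⟨fun h => letterPerm_ne_one hℓ c (right_eq_mul.mp h), c, rfl⟩

theorem wordCayleyGraph_isRegularOfDegree [Fintype I] [Fintype (Equiv.Perm (ReducedWord I ℓ))]
    [DecidableRel (wordCayleyGraph I ℓ).Adj] (hℓ : 0 < ℓ) :
    (wordCayleyGraph I ℓ).IsRegularOfDegree (Fintype.card I * 2) := by
  classical
  intro g
  have : (wordCayleyGraph I ℓ).neighborFinset g =
      (Finset.univ : Finset (I × Bool)).image fun c => letterPerm ℓ c * g := by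
    ext h
    rw [mem_neighborFinset, Finset.mem_image]
    constructor
    · rintro ⟨-, c, rfl⟩
      exact ⟨c, Finset.mem_univ _, rfl⟩
    · rintro ⟨c, -, rfl⟩
      exact wordCayleyGraph_adj_letterPerm_mul hℓ c g
  rw [← card_neighborFinset_eq_degree, this, Finset.card_image_of_injective, Finset.card_univ,
    Fintype.card_prod, Fintype.card_bool]
  intro c c' h
  exact letterPerm_injective hℓ (mul_right_cancel h)

/-- Each vertex and each generator span a triangle. A triangle arises at most three times: a choice
of base vertex in it determines the generator, as distinct letters act differently. -/
theorem mul_le_rex_of_free_wordCayleyGraph [Fintype I]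
    [Fintype (Equiv.Perm (ReducedWord I ℓ))] (hℓ : 0 < ℓ)
    {W : Type*} {F : SimpleGraph W} (hF : F.Free (wordCayleyGraph I ℓ)) :
    Fintype.card (Equiv.Perm (ReducedWord I ℓ)) * Fintype.card I ≤
      3 * rex (Fintype.card (Equiv.Perm (ReducedWord I ℓ))) (completeGraph (Fin 3)) F := by
  classical
  let tri : Equiv.Perm (ReducedWord I ℓ) × I → Finset (Equiv.Perm (ReducedWord I ℓ)) := fun x =>
    {x.1, letterPerm ℓ (x.2, false) * x.1, letterPerm ℓ (x.2, true) * x.1}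
  have htri : ∀ x, (wordCayleyGraph I ℓ).IsNClique 3 (tri x) := by
    intro x
    refine is3Clique_iff.mpr ⟨_, _, _, wordCayleyGraph_adj_letterPerm_mul hℓ _ _,
      wordCayleyGraph_adj_letterPerm_mul hℓ _ _, ?_, rfl⟩
    have := wordCayleyGraph_adj_letterPerm_mul hℓ (x.2, false) (letterPerm ℓ (x.2, false) * x.1)
    rwa [← mul_assoc, letterPerm_mul_letterPerm_same] at this
  have hrex := card_triangles_le_rex (wordCayleyGraph I ℓ)
    (wordCayleyGraph_isRegularOfDegree hℓ) hF (Finset.univ.image tri) (by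
      intro t ht
      obtain ⟨x, -, rfl⟩ := Finset.mem_image.mp ht
      exact htri x)
  have hcount : (Finset.univ : Finset (Equiv.Perm (ReducedWord I ℓ) × I)).card ≤
      3 * (Finset.univ.image tri).card := by
    refine Finset.card_le_mul_card_image _ 3 fun t ht => ?_
    obtain ⟨y, -, rfl⟩ := Finset.mem_image.mp ht
    rw [← (htri y).card_eq]
    refine Finset.card_le_card_of_injOn Prod.fst ?_ ?_
    · intro x hx
      have hx : tri x = tri y := (Finset.mem_filter.mp hx).2
      rw [← hx]
      simp [tri]
    · rintro ⟨g, i⟩ hx ⟨g', j⟩ hx' (rfl : g = g')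
      have hx : tri (g, i) = tri y := (Finset.mem_filter.mp hx).2
      have hx' : tri (g, j) = tri y := (Finset.mem_filter.mp hx').2
      have hmem : letterPerm ℓ (i, false) * g ∈ tri (g, j) := by
        rw [hx', ← hx]
        simp [tri]
      simp only [tri, Finset.mem_insert, Finset.mem_singleton, mul_left_inj] at hmem
      rcases hmem with h | h | h
      · exact absurd (mul_eq_right.mp h) (letterPerm_ne_one hℓ _)
      · rw [(Prod.mk.inj (letterPerm_injective hℓ h)).1]
      · rw [(Prod.mk.inj (letterPerm_injective hℓ h)).1]
  rw [Finset.card_univ, Fintype.card_prod] at hcount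
  exact hcount.trans (Nat.mul_le_mul_left 3 hrex)

/-- The Cayley graph has no cycle of length `ℓ`. Along such a cycle, the image of the empty word
never gets back to the empty word. -/
theorem not_isCycle_wordCayleyGraph (hℓ : 4 ≤ ℓ) {u : Equiv.Perm (ReducedWord I ℓ)}
    (p : (wordCayleyGraph I ℓ).Walk u u) (hp : p.IsCycle) : p.length ≠ ℓ := by
  classical
  intro hlen
  set v : ℕ → Equiv.Perm (ReducedWord I ℓ) := p.getVert with hv
  -- Multiplying by `(v 0)⁻¹` makes the trajectory start at the empty word.
  let x : ℕ → ReducedWord I ℓ := fun j => (v j * (v 0)⁻¹) (emptyWord I ℓ)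
  have hx0 : x 0 = emptyWord I ℓ := by simp [x]
  have hvℓ : v ℓ = v 0 := p.getVert_of_length_le hlen.le |>.trans p.getVert_zero.symm
  have hinj : ∀ i j, i < ℓ → j < ℓ → v i = v j → i = j := fun i j hi hj h =>
    hp.getVert_injOn' (by simp only [Set.mem_ofPred_eq]; omega)
      (by simp only [Set.mem_ofPred_eq]; omega) h
  have hstep : ∀ j < ℓ, ∃ c, v (j + 1) = letterPerm ℓ c * v j := fun j hj =>
    (p.adj_getVert_succ (by omega)).2
  have hxc : ∀ j k c, v k = letterPerm ℓ c * v j → x k = letterPerm ℓ c (x j) := by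
    intro j k c h
    simp only [x, h, Equiv.Perm.mul_apply]
  -- the word at time `j` is obtained by one letter from the word at an earlier time `m`, and the
  -- walk stays in one triangle in between
  let Inv : ℕ → Prop := fun j => ∃ m < j, ∃ c : I × Bool, v j = letterPerm ℓ c * v m ∧
    (∀ a ∈ (x m).1.head?, c.1 ≠ a.1) ∧ (x j).1 = c :: (x m).1 ∧ (x m).1.length ≤ m ∧
    ∀ k, m ≤ k → k ≤ j → v k ∈ ({v m, letterPerm ℓ (c.1, false) * v m,
      letterPerm ℓ (c.1, true) * v m} : Finset (Equiv.Perm (ReducedWord I ℓ)))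
  have hmem : ∀ (c : I × Bool) (g : Equiv.Perm (ReducedWord I ℓ)), letterPerm ℓ c * g ∈
      ({g, letterPerm ℓ (c.1, false) * g, letterPerm ℓ (c.1, true) * g} :
        Finset (Equiv.Perm (ReducedWord I ℓ))) := by
    rintro ⟨i, b⟩ g
    cases b <;> simp
  have hnew : ∀ j < ℓ, ∀ c, v (j + 1) = letterPerm ℓ c * v j → (x j).1.length ≤ j →
      (∀ a ∈ (x j).1.head?, c.1 ≠ a.1) → Inv (j + 1) := by
    intro j hj c hc hlj hhead
    refine ⟨j, Nat.lt_succ_self j, c, hc, hhead, ?_, hlj, ?_⟩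
    -- The word at time `j` has length at most `j < ℓ`, so truncation does not interfere.
    · rw [hxc j (j + 1) c hc, letterPerm_apply_of_lt c (x j) hhead (by omega)]
    · intro k hk hk'
      obtain rfl | rfl : k = j ∨ k = j + 1 := by omega
      · simp
      · rw [hc]
        exact hmem c (v j)
  have hInv : ∀ j, j < ℓ → Inv (j + 1) := by
    intro j
    induction j with
    | zero =>
      intro h0
      obtain ⟨c, hc⟩ := hstep 0 h0
      exact hnew 0 h0 c hc (by simp [hx0, emptyWord]) (by simp [hx0, emptyWord])
    | succ j ih =>
      intro hj
      obtain ⟨m, hm, ⟨i, b⟩, hvj, hhead, hxj, hlm, htri⟩ := ih (by omega)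
      obtain ⟨⟨i', b'⟩, hc'⟩ := hstep (j + 1) hj
      by_cases hii : i' = i
      · subst hii
        by_cases hbb : b' = b
        · subst hbb
          have hnext : v (j + 1 + 1) = letterPerm ℓ (i', !b') * v m := by
            rw [hc', hvj, ← mul_assoc, letterPerm_mul_letterPerm_same]
          refine ⟨m, by omega, (i', !b'), hnext, hhead, ?_, hlm, ?_⟩
          · rw [hxc m _ _ hnext, letterPerm_apply_of_lt (i', !b') (x m) hhead (by omega)]
          · intro k hk hk'
            rcases Nat.lt_or_ge (j + 1) k with h | h
            · obtain rfl : k = j + 1 + 1 := by omega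
              rw [hnext]
              exact hmem (i', !b') (v m)
            · exact htri k hk h
        -- The inverse letter leads back to `v m`. On a cycle this is possible only at the closing
        -- step with `m = 0`, but then the first four vertices, distinct because `ℓ ≥ 4`, lie in one
        -- triangle.
        · exfalso
          have hb' : b = !b' := by
            revert hbb
            cases b <;> cases b' <;> simp
          subst hb'
          have hback : v (j + 1 + 1) = v m := by
            rw [hc', hvj, ← mul_assoc, letterPerm_mul_letterPerm_not, one_mul]
          rcases Nat.lt_or_ge (j + 1 + 1) ℓ with h | h
          · have := hinj _ _ h (by omega) hback
            omega
          · have hjl : j + 1 + 1 = ℓ := by omega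
            rw [hjl, hvℓ] at hback
            obtain rfl : 0 = m := hinj _ _ (by omega) (by omega) hback
            have hcard := Finset.card_le_card_of_injOn (s := Finset.range 4) v
              (fun k hk => htri k (Nat.zero_le _) (by
                have := Finset.mem_range.mp hk
                omega))
              (fun k hk k' hk' h => by
                have := Finset.mem_range.mp hk
                have := Finset.mem_range.mp hk'
                exact hinj _ _ (by omega) (by omega) h)
            have := hcard.trans Finset.card_le_three
            simp at this
      · refine hnew (j + 1) hj (i', b') hc' ?_ ?_
        · rw [hxj, List.length_cons]
          omega
        · rw [hxj]
          simpa using hii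
  obtain ⟨k, rfl⟩ : ∃ k, ℓ = k + 1 := ⟨ℓ - 1, by omega⟩
  obtain ⟨m, -, c, -, -, hx, -⟩ := hInv k (by omega)
  have : x (k + 1) = emptyWord I (k + 1) := by
    rw [← hx0]
    simp only [x, hvℓ]
  rw [this] at hx
  simp [emptyWord] at hx

end Cayley

theorem not_isBigO_rex_of_isCycle {W : Type*} {F : SimpleGraph W} {u : W} {p : F.Walk u u}
    (hp : p.IsCycle) (h3 : p.length ≠ 3) :
    ¬ ((fun n : ℕ => (rex n (completeGraph (Fin 3)) F : ℝ)) =O[atTop] fun n : ℕ => (n : ℝ)) := by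
  classical
  have h4 : 4 ≤ p.length := by
    have := hp.three_le_length
    omega
  refine not_isBigO_rex_of_forall_exists fun C => ?_
  -- The factor 3 cancels the multiplicity of the triangle count and leaves at least `(C + 1) * n`
  -- triangles.
  let I := Fin (3 * (C + 1))
  have := Fintype.ofFinite (Equiv.Perm (ReducedWord I p.length))
  have hfree : F.Free (wordCayleyGraph I p.length) := by
    rintro ⟨f⟩
    exact not_isCycle_wordCayleyGraph h4 (p.map f.toHom) (hp.map f.injective)
      (p.length_map f.toHom)
  have hrex := mul_le_rex_of_free_wordCayleyGraph (by omega) hfree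
  have hcard := Fintype.card_le_of_injective _
    (letterPerm_injective (I := I) (ℓ := p.length) (by omega))
  rw [Fintype.card_prod, Fintype.card_bool] at hcard
  have hI : Fintype.card I = 3 * (C + 1) := Fintype.card_fin _
  rw [hI] at hrex hcard
  refine ⟨Fintype.card (Equiv.Perm (ReducedWord I p.length)), by omega, ?_⟩
  nlinarith

end SimpleGraph

theorem theorem2 {W : Type*} [Finite W] [Nonempty W] (F : SimpleGraph W) :
    ((fun n : ℕ => (SimpleGraph.rex n (SimpleGraph.completeGraph (Fin 3)) F : ℝ)) =O[atTop]
      (fun n : ℕ => (n : ℝ))) ↔ F.IsExtendedFriendship := by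
  constructor
  · intro h
    refine ⟨fun u p hp => ?_, ?_⟩
    · by_contra h3
      exact SimpleGraph.not_isBigO_rex_of_isCycle hp h3 h
    · by_contra hF
      exact SimpleGraph.not_isBigO_rex_of_not_common_vertex hF h
  · intro hF
    have := Fintype.ofFinite W
    refine IsBigO.of_bound (27 * (Fintype.card W : ℝ) ^ 2) (Eventually.of_forall fun n => ?_)
    rw [Real.norm_natCast, Real.norm_natCast]
    exact_mod_cast hF.rex_triangle_le n
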